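/- Let $H$ and $U$ be (real or complex) Hilbert spaces, let $A\colon H\supset D(A)\to H$ be a linear operator generating a strongly continuous contraction semigroup $\{e^{tA}\}_{t\ge 0}$ on $H$, let $B\colon U\to H$ be a bounded linear operator with adjoint $B^*$, and let $0<\mu\le T$. A $T$-$\mu$ PE-signal is a measurable function $\alpha\colon[0,\infty)\to[0,1]$ such that $\int_t^{t+T}\alpha(s)\,ds\ge\mu$ for all $t\ge 0$. Assume the $T$-$\mu$ PE unique continuation property: there exists $\vartheta>0$ such that for all $T$-$\mu$ PE-signals $\alpha$ and all $z_0\in H$, $$\int_0^\vartheta \alpha(t)\,\|B^*e^{tA}z_0\|_U^2\,dt=0\quad\Longrightarrow\quad z_0=0 .$$ Then for every $z_0\in H$ and every $T$-$\mu$ PE-signal $\alpha$, every mild solution $z$ of $\dot z(t)=Az(t)-\alpha(t)BB^*z(t)$, $z(0)=z_0$, i.e. every continuous $z\colon[0,\infty)\to H$ with $$z(t)=e^{tA}z_0-\int_0^t e^{(t-s)A}\alpha(s)BB^*z(s)\,ds\qquad\text{for all } t\ge 0,$$ converges weakly to $0$ in $H$ as $t\to\infty$. -/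

import Mathlib

open MeasureTheory Filter Topology Set

/-- The (possibly unbounded) operator `A` on `H` generates the strongly continuous contraction
semigroup `S`, where `S t` stands for `e^{tA}`. Only the values `S t` with `0 ≤ t` matter. -/
structure GeneratesContractionSemigroup {𝕜 H : Type*} [RCLike 𝕜] [NormedAddCommGroup H]
    [InnerProductSpace 𝕜 H] (A : H →ₗ.[𝕜] H) (S : ℝ → H →L[𝕜] H) : Prop where
  map_zero : S 0 = ContinuousLinearMap.id 𝕜 H
  map_add : ∀ s t : ℝ, 0 ≤ s → 0 ≤ t → S (s + t) = (S s).comp (S t)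
  /-- Strong continuity: every orbit is continuous on `[0, ∞)`. -/
  continuousOn_orbit : ∀ x : H, ContinuousOn (fun t : ℝ => S t x) (Ici 0)
  norm_le_one : ∀ t : ℝ, 0 ≤ t → ‖S t‖ ≤ 1
  /-- `A` is the infinitesimal generator: `x` lies in the domain of `A` and `A x = y` exactly when
  the right derivative at `0` of the orbit of `x` exists and equals `y`. -/
  mem_graph_iff : ∀ x y : H, (x, y) ∈ A.graph ↔
    Tendsto (fun t : ℝ => ((t⁻¹ : ℝ) : 𝕜) • (S t x - x)) (𝓝[>] 0) (𝓝 y)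

/-- `T`-`μ` persistently exciting signals: (Lebesgue) measurable functions `[0, ∞) → [0, 1]` whose
integral over each window `[t, t + T]` with `0 ≤ t` is at least `μ`. A signal is represented by a
function on `ℝ` of which only the values on `[0, ∞)` matter. -/
structure IsPESignal (T μ : ℝ) (α : ℝ → ℝ) : Prop where
  aemeasurable : AEMeasurable α (volume.restrict (Ici 0))
  mem_Icc : ∀ t : ℝ, 0 ≤ t → α t ∈ Icc (0 : ℝ) 1
  le_integral : ∀ t : ℝ, 0 ≤ t → μ ≤ ∫ s in t..(t + T), α s

/-- `T`-`μ` PE unique continuation property: there is `ϑ > 0` such that, for every `T`-`μ`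
PE-signal `α`, if `∫_0^ϑ α(t) ‖B* e^{tA} z₀‖² dt = 0` then `z₀ = 0`. -/
def PEUniqueContinuation {𝕜 H U : Type*} [RCLike 𝕜]
    [NormedAddCommGroup H] [InnerProductSpace 𝕜 H] [CompleteSpace H]
    [NormedAddCommGroup U] [InnerProductSpace 𝕜 U] [CompleteSpace U]
    (S : ℝ → H →L[𝕜] H) (B : U →L[𝕜] H) (T μ : ℝ) : Prop :=
  ∃ ϑ : ℝ, 0 < ϑ ∧ ∀ α : ℝ → ℝ, IsPESignal T μ α → ∀ z₀ : H,
    (∫ t in (0 : ℝ)..ϑ, α t * ‖(ContinuousLinearMap.adjoint B) (S t z₀)‖ ^ 2) = 0 → z₀ = 0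

/-- `z` is a mild solution on `[0, ∞)` of `z' = A z - α B B* z`, `z(0) = z₀`, where `S t = e^{tA}`:
a continuous function on `[0, ∞)` satisfying the variation of constants formula. -/
structure IsMildSolution {𝕜 H U : Type*} [RCLike 𝕜]
    [NormedAddCommGroup H] [InnerProductSpace 𝕜 H] [CompleteSpace H]
    [NormedSpace ℝ H] [IsScalarTower ℝ 𝕜 H]
    [NormedAddCommGroup U] [InnerProductSpace 𝕜 U] [CompleteSpace U]
    (S : ℝ → H →L[𝕜] H) (B : U →L[𝕜] H) (α : ℝ → ℝ) (z₀ : H) (z : ℝ → H) : Prop where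
  continuousOn : ContinuousOn z (Ici 0)
  eq_duhamel : ∀ t : ℝ, 0 ≤ t → z t =
    S t z₀ - ∫ s in (0 : ℝ)..t, S (t - s) (α s • B ((ContinuousLinearMap.adjoint B) (z s)))

/-! The energy inequality `norm_sq_add_integral_le` bounds every orbit and makes `α ‖B* z‖²`
integrable on the half-line, so the dissipation over windows of fixed length vanishes at infinity.
By Duhamel, `z (t n + h) - S h (z (t n))` then tends to `0` in norm along any `t n → ∞`
(`tendsto_sub_semigroup`).

If `z (t n)` converges weakly to `y`, then `z (t n + s)` converges weakly to `S s y`. Together with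
the vanishing dissipation this gives `∫ α (t n + s) ‖B* S s y‖² → 0` on bounded intervals
(`weak_limit_eq_zero`).

No limit of the translated signals is extracted. They put asymptotically no mass where `B* S s y ≠
0`, so the indicator of the zero set is itself a PE signal (`isPESignal_indicator_zero_set`). Unique
continuation for that signal forces `y = 0`, and weak sequential compactness of bounded sets
concludes. -/

/-! ### Joint continuity of the semigroup -/

namespace GeneratesContractionSemigroup

variable {𝕜 H : Type*} [RCLike 𝕜] [NormedAddCommGroup H] [InnerProductSpace 𝕜 H]
  {A : H →ₗ.[𝕜] H} {S : ℝ → H →L[𝕜] H}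

theorem norm_apply_le (hS : GeneratesContractionSemigroup A S) {t : ℝ} (ht : 0 ≤ t) (x : H) :
    ‖S t x‖ ≤ ‖x‖ := by
  simpa using (S t).le_of_opNorm_le (hS.norm_le_one t ht) x

/-- Contractivity makes the orbit maps equicontinuous, which upgrades strong continuity to joint
continuity. -/
theorem continuousOn_apply {X : Type*} [TopologicalSpace X]
    (hS : GeneratesContractionSemigroup A S) {τ : X → ℝ} {u : X → H} {K : Set X}
    (hτ : ContinuousOn τ K) (hτ0 : ∀ x ∈ K, 0 ≤ τ x) (hu : ContinuousOn u K) :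
    ContinuousOn (fun x => S (τ x) (u x)) K := by
  intro x₀ hx₀
  have h₁ : Tendsto (fun x => S (τ x) (u x₀)) (𝓝[K] x₀) (𝓝 (S (τ x₀) (u x₀))) :=
    ((hS.continuousOn_orbit (u x₀)).comp hτ hτ0) x₀ hx₀
  have h₂ : Tendsto (fun x => ‖u x - u x₀‖) (𝓝[K] x₀) (𝓝 0) :=
    tendsto_iff_norm_sub_tendsto_zero.1 (hu x₀ hx₀)
  have h₃ : Tendsto (fun x => S (τ x) (u x - u x₀)) (𝓝[K] x₀) (𝓝 0) := by
    refine squeeze_zero_norm' ?_ h₂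
    filter_upwards [self_mem_nhdsWithin] with x hx
    exact hS.norm_apply_le (hτ0 x hx) _
  have h₄ := h₃.add h₁
  simpa [ContinuousWithinAt] using h₄

end GeneratesContractionSemigroup

/-! ### Integrals and translates of PE signals -/

namespace IsPESignal

variable {T μ : ℝ} {α : ℝ → ℝ}

theorem intervalIntegrable (hα : IsPESignal T μ α) {a b : ℝ} (ha : 0 ≤ a) (hab : a ≤ b) :
    IntervalIntegrable α volume a b := by
  rw [intervalIntegrable_iff_integrableOn_Ioc_of_le hab]
  have hsub : Ioc a b ⊆ Ici 0 := fun x hx => ha.trans hx.1.le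
  refine (integrable_const (1 : ℝ)).mono'
    (hα.aemeasurable.mono_measure (Measure.restrict_mono hsub le_rfl)).aestronglyMeasurable ?_
  filter_upwards [ae_restrict_mem measurableSet_Ioc] with x hx
  have := hα.mem_Icc x (hsub hx)
  rw [Real.norm_of_nonneg this.1]
  exact this.2

theorem intervalIntegrable_smul {E : Type*} [NormedAddCommGroup E] [NormedSpace ℝ E]
    (hα : IsPESignal T μ α) {a b : ℝ} (ha : 0 ≤ a) (hab : a ≤ b) {f : ℝ → E}
    (hf : ContinuousOn f (Icc a b)) :
    IntervalIntegrable (fun s => α s • f s) volume a b := by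
  have h := hα.intervalIntegrable ha hab
  rw [intervalIntegrable_iff_integrableOn_Icc_of_le hab] at h ⊢
  exact h.smul_continuousOn hf isCompact_Icc

theorem mul_sq_nonneg (hα : IsPESignal T μ α) {t : ℝ} (ht : 0 ≤ t) (x : ℝ) :
    0 ≤ α t * x ^ 2 :=
  mul_nonneg (hα.mem_Icc t ht).1 (sq_nonneg _)

theorem integral_mem_Icc (hα : IsPESignal T μ α) {a b : ℝ} (ha : 0 ≤ a) (hab : a ≤ b) :
    ∫ s in a..b, α s ∈ Icc 0 (b - a) := by
  constructor
  · exact intervalIntegral.integral_nonneg hab fun s hs => (hα.mem_Icc s (ha.trans hs.1)).1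
  · have := intervalIntegral.integral_mono_on hab (hα.intervalIntegrable ha hab)
      (intervalIntegrable_const (c := (1 : ℝ))) fun s hs => (hα.mem_Icc s (ha.trans hs.1)).2
    simpa using this

theorem comp_add_left (hα : IsPESignal T μ α) {c : ℝ} (hc : 0 ≤ c) :
    IsPESignal T μ fun s => α (c + s) where
  aemeasurable := by
    have h : MeasurePreserving (fun s : ℝ => c + s) (volume.restrict ((fun s => c + s) ⁻¹' Ici c))
        (volume.restrict (Ici c)) :=
      (measurePreserving_add_left volume c).restrict_preimage measurableSet_Ici
    have h' := (hα.aemeasurable.mono_measure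
      (Measure.restrict_mono (Ici_subset_Ici.2 hc) le_rfl)).comp_quasiMeasurePreserving
        h.quasiMeasurePreserving
    simpa [Function.comp_def] using h'
  mem_Icc t ht := hα.mem_Icc _ (add_nonneg hc ht)
  le_integral t ht := by
    have h := hα.le_integral (c + t) (add_nonneg hc ht)
    rwa [intervalIntegral.integral_comp_add_left, ← add_assoc]

end IsPESignal

/-! ### Duhamel's formula -/

namespace IsMildSolution

variable {𝕜 H U : Type*} [RCLike 𝕜]
    [NormedAddCommGroup H] [InnerProductSpace 𝕜 H] [CompleteSpace H]
    [NormedSpace ℝ H] [IsScalarTower ℝ 𝕜 H]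
    [NormedAddCommGroup U] [InnerProductSpace 𝕜 U] [CompleteSpace U]
    {A : H →ₗ.[𝕜] H} {S : ℝ → H →L[𝕜] H} {B : U →L[𝕜] H} {T μ : ℝ} {α : ℝ → ℝ} {z₀ : H}
    {z : ℝ → H}

theorem map_zero (hS : GeneratesContractionSemigroup A S) (hz : IsMildSolution S B α z₀ z) :
    z 0 = z₀ := by
  simpa [hS.map_zero] using hz.eq_duhamel 0 le_rfl

theorem continuousOn_adjoint (hz : IsMildSolution S B α z₀ z) :
    ContinuousOn (fun s => ContinuousLinearMap.adjoint B (z s)) (Ici 0) :=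
  (ContinuousLinearMap.adjoint B).continuous.comp_continuousOn hz.continuousOn

theorem continuousOn_adjoint_sq (hz : IsMildSolution S B α z₀ z) :
    ContinuousOn (fun s => ‖ContinuousLinearMap.adjoint B (z s)‖ ^ 2) (Ici 0) :=
  hz.continuousOn_adjoint.norm.pow 2

theorem intervalIntegrable_adjoint_sq (hα : IsPESignal T μ α) (hz : IsMildSolution S B α z₀ z)
    {a b : ℝ} (ha : 0 ≤ a) (hab : a ≤ b) :
    IntervalIntegrable (fun s => α s * ‖ContinuousLinearMap.adjoint B (z s)‖ ^ 2) volume a b :=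
  hα.intervalIntegrable_smul ha hab
    (hz.continuousOn_adjoint_sq.mono fun _ hx => ha.trans hx.1)

theorem continuousOn_convolution (hS : GeneratesContractionSemigroup A S)
    (hz : IsMildSolution S B α z₀ z) {a b t : ℝ} (ha : 0 ≤ a) (hb : b ≤ t) :
    ContinuousOn (fun s => S (t - s) (B (ContinuousLinearMap.adjoint B (z s)))) (Icc a b) := by
  refine hS.continuousOn_apply (by fun_prop) (fun x hx => sub_nonneg.2 (hx.2.trans hb)) ?_
  exact B.continuous.comp_continuousOn (hz.continuousOn_adjoint.mono fun _ hx => ha.trans hx.1)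

theorem intervalIntegrable_convolution (hS : GeneratesContractionSemigroup A S)
    (hα : IsPESignal T μ α) (hz : IsMildSolution S B α z₀ z) {a b t : ℝ} (ha : 0 ≤ a)
    (hab : a ≤ b) (hb : b ≤ t) :
    IntervalIntegrable (fun s => S (t - s) (α s • B (ContinuousLinearMap.adjoint B (z s))))
      volume a b := by
  simpa only [ContinuousLinearMap.map_smul_of_tower] using
    hα.intervalIntegrable_smul ha hab (hz.continuousOn_convolution hS ha hb)

/-- The variation of constants formula restarted at time `t`. -/
theorem map_add (hS : GeneratesContractionSemigroup A S) (hα : IsPESignal T μ α)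
    (hz : IsMildSolution S B α z₀ z) {t h : ℝ} (ht : 0 ≤ t) (hh : 0 ≤ h) :
    z (t + h) = S h (z t) -
      ∫ s in t..(t + h), S (t + h - s) (α s • B (ContinuousLinearMap.adjoint B (z s))) := by
  have hth : t ≤ t + h := le_add_of_nonneg_right hh
  rw [hz.eq_duhamel (t + h) (add_nonneg ht hh), hz.eq_duhamel t ht, map_sub,
    ← (S h).intervalIntegral_comp_comm (hz.intervalIntegrable_convolution hS hα le_rfl ht le_rfl),
    ← intervalIntegral.integral_add_adjacent_intervals
      (hz.intervalIntegrable_convolution hS hα le_rfl ht hth)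
      (hz.intervalIntegrable_convolution hS hα ht hth le_rfl), ← sub_sub]
  congr 2
  · rw [add_comm, hS.map_add h t hh ht]; rfl
  · refine intervalIntegral.integral_congr fun s hs => ?_
    rw [uIcc_of_le ht] at hs
    have : t + h - s = h + (t - s) := by ring
    simp only [this, hS.map_add h (t - s) hh (sub_nonneg.2 hs.2), ContinuousLinearMap.comp_apply]

end IsMildSolution

/-! ### Energy inequality -/

/-- One time step of length `h`, with `a = z t`, `p = S h a`, `w = B B* a`, `β` the integral of `α`
over the step and `y = z (t + h)`. Expanding `‖p - β • w‖²` leaves errors of size `ε * h`; the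
quadratic term is one of them because `β ≤ h ≤ ε`. -/
theorem norm_sq_le_of_norm_sub_le {𝕜 H : Type*} [RCLike 𝕜] [NormedAddCommGroup H]
    [InnerProductSpace 𝕜 H] [NormedSpace ℝ H] [IsScalarTower ℝ 𝕜 H]
    {a p w y : H} {β h ε : ℝ} (hβ : β ∈ Icc 0 h) (hε : ε ≤ 1) (hhε : h ≤ ε)
    (hp : ‖p‖ ≤ ‖a‖) (hpa : ‖p - a‖ ≤ ε) (hy : ‖y - p + β • w‖ ≤ ε * h) :
    ‖y‖ ^ 2 ≤ ‖a‖ ^ 2 - 2 * β * RCLike.re (inner 𝕜 a w) +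
      ε * h * (2 * ‖w‖ + ‖w‖ ^ 2 + 2 * (‖a‖ + ‖w‖) + 1) := by
  obtain ⟨hβ0, hβh⟩ := hβ
  have hh : 0 ≤ h := hβ0.trans hβh
  have hε0 : 0 ≤ ε := hh.trans hhε
  have hw := norm_nonneg w
  have ha := norm_nonneg a
  have hβw : ‖β • w‖ = β * ‖w‖ := by rw [norm_smul, Real.norm_of_nonneg hβ0]
  have hq : ‖p - β • w‖ ≤ ‖a‖ + ‖w‖ := by
    refine (norm_sub_le _ _).trans (add_le_add hp ?_)
    rw [hβw]
    exact mul_le_of_le_one_left hw (hβh.trans (hhε.trans hε))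
  have hy' : ‖y‖ ≤ ‖p - β • w‖ + ε * h := by
    have : y = (p - β • w) + (y - p + β • w) := by abel
    calc ‖y‖ = ‖(p - β • w) + (y - p + β • w)‖ := by rw [← this]
      _ ≤ _ := (norm_add_le _ _).trans (by gcongr)
  have hin : RCLike.re (inner 𝕜 p (β • w)) = β * RCLike.re (inner 𝕜 p w) := by
    rw [RCLike.real_smul_eq_coe_smul (K := 𝕜), inner_smul_right, RCLike.re_ofReal_mul]
  have hsq : ‖p - β • w‖ ^ 2 =
      ‖p‖ ^ 2 - 2 * (β * RCLike.re (inner 𝕜 p w)) + (β * ‖w‖) ^ 2 := by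
    rw [norm_sub_sq (𝕜 := 𝕜), hin, hβw]
  have hdiff : RCLike.re (inner 𝕜 a w) - RCLike.re (inner 𝕜 p w) ≤ ε * ‖w‖ := by
    rw [← map_sub, ← inner_sub_left]
    refine (re_inner_le_norm _ _).trans ?_
    rw [norm_sub_rev]
    gcongr
  have e1 : ‖y‖ ^ 2 ≤ (‖p - β • w‖ + ε * h) ^ 2 := by gcongr
  have e2 : ‖p‖ ^ 2 ≤ ‖a‖ ^ 2 := by gcongr
  have e3 : β * (RCLike.re (inner 𝕜 a w) - RCLike.re (inner 𝕜 p w)) ≤ h * (ε * ‖w‖) :=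
    (mul_le_mul_of_nonneg_left hdiff hβ0).trans (by gcongr)
  have e4 : (β * ‖w‖) ^ 2 ≤ ε * h * ‖w‖ ^ 2 := by
    rw [mul_pow]
    refine mul_le_mul_of_nonneg_right ?_ (by positivity)
    calc β ^ 2 = β * β := sq β
      _ ≤ ε * h := mul_le_mul (hβh.trans hhε) hβh hβ0 hε0
  have e5 : 2 * (ε * h) * ‖p - β • w‖ ≤ 2 * (ε * h) * (‖a‖ + ‖w‖) := by gcongr
  have e6 : (ε * h) ^ 2 ≤ ε * h := by
    have : ε * h ≤ 1 := mul_le_one₀ hε hh (hhε.trans hε)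
    have h0 : 0 ≤ ε * h := by positivity
    nlinarith
  nlinarith

namespace IsMildSolution

variable {𝕜 H U : Type*} [RCLike 𝕜]
    [NormedAddCommGroup H] [InnerProductSpace 𝕜 H] [CompleteSpace H]
    [NormedSpace ℝ H] [IsScalarTower ℝ 𝕜 H]
    [NormedAddCommGroup U] [InnerProductSpace 𝕜 U] [CompleteSpace U]
    {A : H →ₗ.[𝕜] H} {S : ℝ → H →L[𝕜] H} {B : U →L[𝕜] H} {T μ : ℝ} {α : ℝ → ℝ} {z₀ : H}
    {z : ℝ → H}

/-- Joint continuity at `(t, t)` allows the Duhamel integrand to be frozen at `w`. As `α` is only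
measurable, its integral is kept instead of `α t * (y - t)`. -/
theorem eventually_norm_increment_le (hS : GeneratesContractionSemigroup A S)
    (hα : IsPESignal T μ α) (hz : IsMildSolution S B α z₀ z) {t ε : ℝ} (ht : 0 ≤ t) (hε : 0 < ε) :
    ∀ᶠ y in 𝓝[>] t, ‖z y - S (y - t) (z t) +
      (∫ s in t..y, α s) • B (ContinuousLinearMap.adjoint B (z t))‖ ≤ ε * (y - t) := by
  set w := B (ContinuousLinearMap.adjoint B (z t)) with hw
  have hcont : ContinuousOn (fun p : ℝ × ℝ => S (p.1 - p.2)
      (B (ContinuousLinearMap.adjoint B (z p.2)))) {p | t ≤ p.2 ∧ p.2 ≤ p.1} := by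
    refine hS.continuousOn_apply (by fun_prop) (fun p hp => sub_nonneg.2 hp.2) ?_
    refine B.continuous.comp_continuousOn (hz.continuousOn_adjoint.comp continuousOn_snd ?_)
    exact fun p hp => ht.trans hp.1
  have hpt := hcont (t, t) ⟨le_rfl, le_rfl⟩
  rw [ContinuousWithinAt, Metric.tendsto_nhdsWithin_nhds] at hpt
  obtain ⟨δ, hδ, hball⟩ := hpt ε hε
  filter_upwards [Ioo_mem_nhdsGT (lt_add_of_pos_right t hδ)] with y hy
  have hty : t ≤ y := hy.1.le
  have hI := hz.map_add hS hα ht (sub_nonneg.2 hty)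
  rw [add_sub_cancel] at hI
  have hI₁ := hz.intervalIntegrable_convolution hS hα ht hty le_rfl
  have hI₂ : IntervalIntegrable (fun s => α s • w) volume t y :=
    hα.intervalIntegrable_smul ht hty continuousOn_const
  have heq : z y - S (y - t) (z t) + (∫ s in t..y, α s) • w =
      -∫ s in t..y, (S (y - s) (α s • B (ContinuousLinearMap.adjoint B (z s))) - α s • w) := by
    rw [hI, intervalIntegral.integral_sub hI₁ hI₂, intervalIntegral.integral_smul_const]
    abel
  rw [heq, norm_neg]
  refine (intervalIntegral.norm_integral_le_of_norm_le_const (C := ε) fun s hs => ?_).trans ?_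
  · rw [uIoc_of_le hty] at hs
    have h₁ := hα.mem_Icc s (ht.trans hs.1.le)
    have h₂ := hball (x := (y, s)) ⟨hs.1.le, hs.2⟩ (by
      rw [Prod.dist_eq, max_lt_iff, Real.dist_eq, Real.dist_eq, abs_lt, abs_lt]
      refine ⟨⟨?_, ?_⟩, ⟨?_, ?_⟩⟩ <;> dsimp <;> linarith [hs.1, hs.2, hy.1, hy.2])
    simp only [sub_self, hS.map_zero, ContinuousLinearMap.id_apply, dist_eq_norm] at h₂
    rw [ContinuousLinearMap.map_smul_of_tower, ← smul_sub, norm_smul, Real.norm_of_nonneg h₁.1]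
    exact (mul_le_of_le_one_left (norm_nonneg _) h₁.2).trans h₂.le
  · rw [abs_of_nonneg (sub_nonneg.2 hty)]

theorem eventually_integral_adjoint_sq_le (hα : IsPESignal T μ α) (hz : IsMildSolution S B α z₀ z)
    {t ε : ℝ} (ht : 0 ≤ t) (hε : 0 < ε) :
    ∀ᶠ y in 𝓝[>] t, ∫ s in t..y, α s * ‖ContinuousLinearMap.adjoint B (z s)‖ ^ 2 ≤
      (∫ s in t..y, α s) * ‖ContinuousLinearMap.adjoint B (z t)‖ ^ 2 + ε * (y - t) := by
  have hpt := hz.continuousOn_adjoint_sq t ht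
  rw [ContinuousWithinAt, Metric.tendsto_nhdsWithin_nhds] at hpt
  obtain ⟨δ, hδ, hball⟩ := hpt ε hε
  filter_upwards [Ioo_mem_nhdsGT (lt_add_of_pos_right t hδ)] with y hy
  have hty : t ≤ y := hy.1.le
  have hc : IntervalIntegrable
      (fun s => α s * ‖ContinuousLinearMap.adjoint B (z t)‖ ^ 2) volume t y :=
    (hα.intervalIntegrable ht hty).mul_const _
  calc ∫ s in t..y, α s * ‖ContinuousLinearMap.adjoint B (z s)‖ ^ 2
      ≤ ∫ s in t..y, (α s * ‖ContinuousLinearMap.adjoint B (z t)‖ ^ 2 + ε) := by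
        refine intervalIntegral.integral_mono_on hty (hz.intervalIntegrable_adjoint_sq hα ht hty)
          (hc.add intervalIntegrable_const) fun s hs => ?_
        have h₁ := hα.mem_Icc s (ht.trans hs.1)
        have h₂ := hball (x := s) (ht.trans hs.1) (by
          rw [Real.dist_eq, abs_lt]
          constructor <;> linarith [hs.1, hs.2, hy.1, hy.2])
        rw [Real.dist_eq, abs_lt] at h₂
        have h₃ := h₂.2
        have : α s * (‖ContinuousLinearMap.adjoint B (z s)‖ ^ 2 -
            ‖ContinuousLinearMap.adjoint B (z t)‖ ^ 2) ≤ ε := by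
          by_cases h0 : 0 ≤ ‖ContinuousLinearMap.adjoint B (z s)‖ ^ 2 -
            ‖ContinuousLinearMap.adjoint B (z t)‖ ^ 2
          · exact (mul_le_of_le_one_left h0 h₁.2).trans h₃.le
          · exact (mul_nonpos_of_nonneg_of_nonpos h₁.1 (not_le.1 h0).le).trans hε.le
        linarith
    _ = _ := by
        rw [intervalIntegral.integral_add hc intervalIntegrable_const,
          intervalIntegral.integral_mul_const, intervalIntegral.integral_const, smul_eq_mul,
          mul_comm (y - t)]

/-- The energy inequality. -/
theorem norm_sq_add_integral_le (hS : GeneratesContractionSemigroup A S) (hα : IsPESignal T μ α)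
    (hz : IsMildSolution S B α z₀ z) {t : ℝ} (ht : 0 ≤ t) :
    ‖z t‖ ^ 2 + 2 * ∫ s in (0 : ℝ)..t, α s * ‖ContinuousLinearMap.adjoint B (z s)‖ ^ 2 ≤
      ‖z₀‖ ^ 2 := by
  set g : ℝ → ℝ := fun s => α s * ‖ContinuousLinearMap.adjoint B (z s)‖ ^ 2 with hg
  have hgi : ∀ {a b : ℝ}, 0 ≤ a → a ≤ b → IntervalIntegrable g volume a b :=
    fun ha hab => hz.intervalIntegrable_adjoint_sq hα ha hab
  -- A mild solution need not be differentiable, so monotonicity of the energy is read off from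
  -- right slopes: each is eventually below any `r > 0`.
  refine image_le_of_liminf_slope_right_le_deriv_boundary
    (f := fun t => ‖z t‖ ^ 2 + 2 * ∫ s in (0 : ℝ)..t, g s) (a := 0) (b := t)
    (B := fun _ => ‖z₀‖ ^ 2) (B' := fun _ => 0) ?_ ?_ continuousOn_const
    (fun x _ => hasDerivWithinAt_const _ _ _) ?_ ⟨ht, le_rfl⟩
  · refine ContinuousOn.add ((hz.continuousOn.mono fun x hx => hx.1).norm.pow 2)
      (continuousOn_const.mul ?_)
    have := intervalIntegral.continuousOn_primitive_interval (μ := volume) (f := g) (a := 0) (b := t)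
      (by rw [uIcc_of_le ht]; exact (intervalIntegrable_iff_integrableOn_Icc_of_le ht).1 (hgi le_rfl ht))
    rwa [uIcc_of_le ht] at this
  · simp [hz.map_zero hS]
  · rintro x ⟨hx, -⟩ r hr
    refine Eventually.frequently ?_
    set w := B (ContinuousLinearMap.adjoint B (z x)) with hw
    set M : ℝ := 2 * ‖w‖ + ‖w‖ ^ 2 + 2 * (‖z x‖ + ‖w‖) + 1 with hM
    have hMpos : 0 < M := by positivity
    -- `M` collects the errors of the squared norm; the extra `2` pays for twice the error of the
    -- dissipation integral.
    set ε : ℝ := min 1 (r / (2 * (M + 2))) with hε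
    have hεpos : 0 < ε := lt_min one_pos (by positivity)
    have hεr : ε * (M + 2) < r := by
      have : ε * (2 * (M + 2)) ≤ r := (le_div_iff₀ (by positivity)).1 (min_le_right _ _)
      have h0 : 0 < ε * (M + 2) := by positivity
      linarith
    have hre : RCLike.re (inner 𝕜 (z x) w) = ‖ContinuousLinearMap.adjoint B (z x)‖ ^ 2 := by
      rw [hw, ← ContinuousLinearMap.adjoint_inner_left, inner_self_eq_norm_sq]
    have hSx : ∀ᶠ y in 𝓝[>] x, ‖S (y - x) (z x) - z x‖ ≤ ε := by
      have hc : ContinuousOn (fun y => S (y - x) (z x)) (Ici x) :=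
        hS.continuousOn_apply (by fun_prop) (fun y hy => sub_nonneg.2 hy) continuousOn_const
      have := (hc x self_mem_Ici).mono Ioi_subset_Ici_self
      rw [ContinuousWithinAt, Metric.tendsto_nhds] at this
      filter_upwards [this ε hεpos] with y hy
      simpa [dist_eq_norm, hS.map_zero] using hy.le
    filter_upwards [hz.eventually_norm_increment_le hS hα hx hεpos,
      hz.eventually_integral_adjoint_sq_le hα hx hεpos, hSx,
      Ioo_mem_nhdsGT (lt_add_of_pos_right x hεpos)] with y h₁ h₂ h₃ hy
    have hxy : 0 < y - x := sub_pos.2 hy.1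
    have h₄ := norm_sq_le_of_norm_sub_le (𝕜 := 𝕜) (hα.integral_mem_Icc hx hy.1.le)
      (min_le_left _ _) (sub_le_iff_le_add'.2 hy.2.le) (hS.norm_apply_le hxy.le (z x)) h₃ h₁
    rw [hre] at h₄
    have h₅ := intervalIntegral.integral_add_adjacent_intervals (hgi le_rfl hx) (hgi hx hy.1.le)
    rw [slope_def_field, div_lt_iff₀ hxy, ← h₅]
    have h₆ : ε * (M + 2) * (y - x) < r * (y - x) := mul_lt_mul_of_pos_right hεr hxy
    linarith

end IsMildSolution

/-! ### Weak sequential compactness -/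

/-- `H` may be nonseparable, so sequential Banach–Alaoglu is applied in the closed span of the
sequence; orthogonal projection then handles every test vector. -/
theorem exists_subseq_tendsto_inner (𝕜 : Type*) {H : Type*} [RCLike 𝕜] [NormedAddCommGroup H]
    [InnerProductSpace 𝕜 H] [CompleteSpace H] {y : ℕ → H} {C : ℝ} (hy : ∀ n, ‖y n‖ ≤ C) :
    ∃ (y' : H) (φ : ℕ → ℕ), StrictMono φ ∧
      ∀ x : H, Tendsto (fun n => inner 𝕜 (y (φ n)) x) atTop (𝓝 (inner 𝕜 y' x)) := by
  set K : Submodule 𝕜 H := (Submodule.span 𝕜 (range y)).topologicalClosure with hK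
  have hyK : ∀ n, y n ∈ K := fun n =>
    Submodule.le_topologicalClosure _ (Submodule.subset_span (mem_range_self n))
  have : CompleteSpace K := (Submodule.isClosed_topologicalClosure _).completeSpace_coe
  have : TopologicalSpace.SeparableSpace K := by
    have h : TopologicalSpace.IsSeparable (K : Set H) :=
      ((countable_range y).isSeparable.span (R := 𝕜)).closure
    exact h.separableSpace
  let f : ℕ → WeakDual 𝕜 K := fun n =>
    StrongDual.toWeakDual (InnerProductSpace.toDual 𝕜 K ⟨y n, hyK n⟩)
  obtain ⟨a, -, φ, hφ, hlim⟩ := WeakDual.isSeqCompact_closedBall 𝕜 K 0 C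
    (x := f) (fun n => by
      simp only [f, mem_preimage, mem_closedBall_zero_iff, StrongDual.toStrongDual_toWeakDual,
        LinearIsometryEquiv.norm_map]
      exact hy n)
  refine ⟨(InnerProductSpace.toDual 𝕜 K).symm (WeakDual.toStrongDual a), φ, hφ, fun x => ?_⟩
  rw [tendsto_iff_forall_eval_tendsto_topDualPairing] at hlim
  have h := hlim (K.orthogonalProjectionOnto x)
  have key : ∀ u : K, inner 𝕜 (u : H) x = inner 𝕜 u (K.orthogonalProjectionOnto x) := fun u => by
    rw [Submodule.inner_orthogonalProjectionOnto_eq_of_mem_left]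
  rw [key, InnerProductSpace.toDual_symm_apply]
  have key' : ∀ n, inner 𝕜 (y (φ n)) x = f (φ n) (K.orthogonalProjectionOnto x) := fun n =>
    key ⟨y (φ n), hyK _⟩
  simp_rw [key']
  exact h

/-! ### The limiting PE signal -/

/-- If PE signals asymptotically avoid the set where a nonnegative function `G` is positive, then
the indicator function of the zero set of `G` is a PE signal. -/
theorem isPESignal_indicator_zero_set {T μ : ℝ} (hT : 0 ≤ T) {α : ℕ → ℝ → ℝ}
    (hα : ∀ n, IsPESignal T μ (α n)) {G : ℝ → ℝ} (hG : Measurable G) (hG0 : ∀ s, 0 ≤ G s)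
    (hGα : ∀ n, ∀ t, 0 ≤ t → IntervalIntegrable (fun s => α n s * G s) volume t (t + T))
    (hlim : ∀ t, 0 ≤ t → Tendsto (fun n => ∫ s in t..(t + T), α n s * G s) atTop (𝓝 0)) :
    IsPESignal T μ ({s | G s = 0}.indicator 1) := by
  have hZ : MeasurableSet {s | G s = 0} := hG (measurableSet_singleton 0)
  have hmeas : Measurable ({s | G s = 0}.indicator (1 : ℝ → ℝ)) := measurable_one.indicator hZ
  have hbd : ∀ s, ({s | G s = 0}.indicator (1 : ℝ → ℝ)) s ∈ Icc (0 : ℝ) 1 := fun s => by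
    by_cases h : G s = 0 <;> simp [indicator, h]
  refine ⟨hmeas.aemeasurable, fun t _ => hbd t, fun t ht => ?_⟩
  have htT : t ≤ t + T := le_add_of_nonneg_right hT
  -- Cutoffs equal to `1` on the zero set of `G` and decreasing pointwise to its indicator.
  set k : ℕ → ℝ → ℝ := fun m s => max 0 (1 - m * G s) with hk
  have hkm : ∀ m, Measurable (k m) := fun m =>
    measurable_const.max (measurable_const.sub (hG.const_mul _))
  have hk1 : ∀ m s, ‖k m s‖ ≤ 1 := fun m s => by
    rw [Real.norm_of_nonneg (le_max_left _ _)]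
    refine max_le zero_le_one ?_
    have := mul_nonneg (Nat.cast_nonneg (α := ℝ) m) (hG0 s)
    linarith
  have hki : ∀ m, IntervalIntegrable (k m) volume t (t + T) := fun m =>
    (intervalIntegrable_const (c := (1 : ℝ))).mono_fun (hkm m).aestronglyMeasurable
      (.of_forall fun s => by simpa using hk1 m s)
  have hbound : ∀ m, μ ≤ ∫ s in t..(t + T), k m s := fun m => by
    -- Pointwise `α n ≤ m * α n * G + k m`. Letting `n → ∞` at fixed `m` removes the first term.
    have hn : ∀ n, μ ≤ m * (∫ s in t..(t + T), α n s * G s) + ∫ s in t..(t + T), k m s := fun n => by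
      rw [← intervalIntegral.integral_const_mul,
        ← intervalIntegral.integral_add ((hGα n t ht).const_mul _) (hki m)]
      refine ((hα n).le_integral t ht).trans (intervalIntegral.integral_mono_on htT
        ((hα n).intervalIntegrable ht htT) (((hGα n t ht).const_mul _).add (hki m)) fun s hs => ?_)
      obtain ⟨h0, h1⟩ := (hα n).mem_Icc s (ht.trans hs.1)
      have h2 : 0 ≤ k m s := le_max_left _ _
      have h3 : 1 - m * G s ≤ k m s := le_max_right _ _
      have h4 := mul_le_mul_of_nonneg_left h3 h0
      have h5 := mul_le_of_le_one_left h2 h1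
      linarith
    have := ((hlim t ht).const_mul (m : ℝ)).add_const (∫ s in t..(t + T), k m s)
    rw [mul_zero, zero_add] at this
    exact ge_of_tendsto' this hn
  refine ge_of_tendsto' (intervalIntegral.tendsto_integral_filter_of_dominated_convergence
    (l := atTop) (F := k) (fun _ => 1) (.of_forall fun m => (hkm m).aestronglyMeasurable)
    (.of_forall fun m => .of_forall fun s _ => hk1 m s) intervalIntegrable_const
    (.of_forall fun s _ => ?_)) hbound
  by_cases h : G s = 0
  · simp [hk, indicator, h]
  · have hpos : 0 < G s := lt_of_le_of_ne (hG0 s) (Ne.symm h)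
    have hzero : ({s | G s = 0}.indicator (1 : ℝ → ℝ)) s = 0 := by simp [indicator, h]
    rw [hzero]
    refine tendsto_const_nhds.congr' ?_
    filter_upwards [(tendsto_natCast_atTop_atTop.atTop_mul_const hpos).eventually_ge_atTop 1]
      with m hm
    exact (max_eq_left (by simpa using hm)).symm

/-! ### Asymptotic comparison with the free evolution -/

namespace IsMildSolution

variable {𝕜 H U : Type*} [RCLike 𝕜]
    [NormedAddCommGroup H] [InnerProductSpace 𝕜 H] [CompleteSpace H]
    [NormedSpace ℝ H] [IsScalarTower ℝ 𝕜 H]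
    [NormedAddCommGroup U] [InnerProductSpace 𝕜 U] [CompleteSpace U]
    {A : H →ₗ.[𝕜] H} {S : ℝ → H →L[𝕜] H} {B : U →L[𝕜] H} {T μ : ℝ} {α : ℝ → ℝ} {z₀ : H}
    {z : ℝ → H}

theorem norm_le (hS : GeneratesContractionSemigroup A S) (hα : IsPESignal T μ α)
    (hz : IsMildSolution S B α z₀ z) {t : ℝ} (ht : 0 ≤ t) : ‖z t‖ ≤ ‖z₀‖ := by
  have h₁ := hz.norm_sq_add_integral_le hS hα ht
  have h₂ : 0 ≤ ∫ s in (0 : ℝ)..t, α s * ‖ContinuousLinearMap.adjoint B (z s)‖ ^ 2 :=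
    intervalIntegral.integral_nonneg ht fun s hs => hα.mul_sq_nonneg hs.1 _
  exact le_of_sq_le_sq (by linarith) (norm_nonneg _)

theorem tendsto_integral_window (hS : GeneratesContractionSemigroup A S) (hα : IsPESignal T μ α)
    (hz : IsMildSolution S B α z₀ z) {t : ℕ → ℝ} (ht0 : ∀ n, 0 ≤ t n) (ht : Tendsto t atTop atTop)
    {h : ℝ} (hh : 0 ≤ h) :
    Tendsto (fun n => ∫ s in (t n)..(t n + h), α s * ‖ContinuousLinearMap.adjoint B (z s)‖ ^ 2)
      atTop (𝓝 0) := by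
  set g : ℝ → ℝ := fun s => α s * ‖ContinuousLinearMap.adjoint B (z s)‖ ^ 2 with hg
  have hgi : ∀ {a b : ℝ}, 0 ≤ a → a ≤ b → IntervalIntegrable g volume a b :=
    fun ha hab => hz.intervalIntegrable_adjoint_sq hα ha hab
  have hint : IntegrableOn g (Ioi 0) := by
    refine integrableOn_Ioi_of_intervalIntegral_norm_bounded (‖z₀‖ ^ 2) 0
      (b := fun n : ℕ => (n : ℝ)) (l := atTop) (fun n => ?_) tendsto_natCast_atTop_atTop
      (.of_forall fun n => ?_)
    · exact (intervalIntegrable_iff_integrableOn_Ioc_of_le n.cast_nonneg).1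
        (hgi le_rfl n.cast_nonneg)
    · have h₁ := hz.norm_sq_add_integral_le hS hα (Nat.cast_nonneg (α := ℝ) n)
      have h₂ : 0 ≤ ∫ s in (0 : ℝ)..n, g s :=
        intervalIntegral.integral_nonneg n.cast_nonneg fun s hs => hα.mul_sq_nonneg hs.1 _
      have h₃ : ∫ s in (0 : ℝ)..n, ‖g s‖ = ∫ s in (0 : ℝ)..n, g s := by
        refine intervalIntegral.integral_congr fun s hs => ?_
        rw [uIcc_of_le n.cast_nonneg] at hs
        exact Real.norm_of_nonneg (hα.mul_sq_nonneg hs.1 _)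
      rw [h₃]
      nlinarith [sq_nonneg ‖z n‖]
  have h₁ := intervalIntegral_tendsto_integral_Ioi 0 hint ht
  have h₂ := intervalIntegral_tendsto_integral_Ioi 0 hint (tendsto_atTop_add_const_right _ h ht)
  have h₃ := h₂.sub h₁
  rw [sub_self] at h₃
  refine h₃.congr fun n => ?_
  rw [← intervalIntegral.integral_add_adjacent_intervals (hgi le_rfl (ht0 n))
    (hgi (ht0 n) (le_add_of_nonneg_right hh)), add_sub_cancel_left]

/-- Young-type splitting `α x ≤ δ + δ⁻¹ α x²`, by the cases `x ≤ δ` and `δ ≤ x`. For fixed `h`,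
first `δ` is taken small, then the window is sent to infinity. -/
theorem norm_sub_le (hS : GeneratesContractionSemigroup A S) (hα : IsPESignal T μ α)
    (hz : IsMildSolution S B α z₀ z) {t h δ : ℝ} (ht : 0 ≤ t) (hh : 0 ≤ h) (hδ : 0 < δ) :
    ‖z (t + h) - S h (z t)‖ ≤ ‖B‖ * (δ * h +
      δ⁻¹ * ∫ s in t..(t + h), α s * ‖ContinuousLinearMap.adjoint B (z s)‖ ^ 2) := by
  have hth : t ≤ t + h := le_add_of_nonneg_right hh
  have hi := hz.intervalIntegrable_adjoint_sq hα ht hth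
  rw [hz.map_add hS hα ht hh, sub_sub_cancel_left, norm_neg]
  have hI : IntervalIntegrable (fun s => ‖B‖ * (δ +
      δ⁻¹ * (α s * ‖ContinuousLinearMap.adjoint B (z s)‖ ^ 2))) volume t (t + h) :=
    (intervalIntegrable_const.add (hi.const_mul _)).const_mul _
  refine (intervalIntegral.norm_integral_le_of_norm_le hth (.of_forall fun s hs => ?_) hI).trans ?_
  · obtain ⟨h0, h1⟩ := hα.mem_Icc s (ht.trans hs.1.le)
    set x := ‖ContinuousLinearMap.adjoint B (z s)‖ with hx
    have hx0 : 0 ≤ x := norm_nonneg _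
    refine (hS.norm_apply_le (sub_nonneg.2 hs.2) _).trans ?_
    rw [norm_smul, Real.norm_of_nonneg h0]
    have hB := B.le_opNorm (ContinuousLinearMap.adjoint B (z s))
    have key : α s * x ≤ δ + δ⁻¹ * (α s * x ^ 2) := by
      rcases le_total x δ with hxδ | hxδ
      · have := mul_le_of_le_one_left hx0 h1
        have : 0 ≤ δ⁻¹ * (α s * x ^ 2) := by positivity
        linarith
      · have h2 : α s * x * 1 ≤ α s * x * (δ⁻¹ * x) := by
          gcongr
          rw [← div_eq_inv_mul, one_le_div hδ]
          exact hxδ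
        nlinarith
    calc α s * ‖B (ContinuousLinearMap.adjoint B (z s))‖ ≤ α s * (‖B‖ * x) := by gcongr
      _ = ‖B‖ * (α s * x) := by ring
      _ ≤ _ := by gcongr
  · rw [intervalIntegral.integral_const_mul,
      intervalIntegral.integral_add intervalIntegrable_const (hi.const_mul _),
      intervalIntegral.integral_const_mul, intervalIntegral.integral_const]
    simp [mul_comm]

theorem tendsto_sub_semigroup (hS : GeneratesContractionSemigroup A S) (hα : IsPESignal T μ α)
    (hz : IsMildSolution S B α z₀ z) {t : ℕ → ℝ} (ht0 : ∀ n, 0 ≤ t n) (ht : Tendsto t atTop atTop)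
    {h : ℝ} (hh : 0 ≤ h) :
    Tendsto (fun n => z (t n + h) - S h (z (t n))) atTop (𝓝 0) := by
  rw [Metric.tendsto_nhds]
  intro ε hε
  set δ : ℝ := ε / (2 * (‖B‖ * h + 1)) with hδ
  have hBh : 0 ≤ ‖B‖ * h := by positivity
  have hδpos : 0 < δ := by positivity
  have hδε : ‖B‖ * (δ * h) < ε := by
    have h₁ : δ * (2 * (‖B‖ * h + 1)) = ε := div_mul_cancel₀ _ (by positivity)
    nlinarith
  have hlim := (((hz.tendsto_integral_window hS hα ht0 ht hh).const_mul δ⁻¹).const_add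
    (δ * h)).const_mul ‖B‖
  rw [mul_zero, add_zero] at hlim
  filter_upwards [hlim.eventually_lt_const hδε] with n hn
  rw [dist_zero_right]
  exact (hz.norm_sub_le hS hα (ht0 n) hh hδpos).trans_lt hn

end IsMildSolution

/-! ### Identification of weak limits -/

/-- Used with `b = B* S s y` fixed and `c = B* z (t n + s)` converging only weakly to it: `b - c`
occurs only inside a pairing with `b`, and `‖c‖²` is controlled by dissipation. -/
theorem norm_sq_le_two_mul_norm_inner_sub_add {𝕜 E : Type*} [RCLike 𝕜] [NormedAddCommGroup E]
    [InnerProductSpace 𝕜 E] (b c : E) :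
    ‖b‖ ^ 2 ≤ 2 * ‖inner 𝕜 b (b - c)‖ + ‖c‖ ^ 2 := by
  have h₁ := norm_sub_sq (𝕜 := 𝕜) b (b - c)
  rw [sub_sub_cancel] at h₁
  have h₂ := RCLike.re_le_norm (inner 𝕜 b (b - c))
  nlinarith [sq_nonneg ‖b - c‖]

/-- A state whose observation through a sequence of PE signals tends to zero vanishes. No limit of
the signals is needed: the indicator function of the unobserved times is a PE signal. -/
theorem PEUniqueContinuation.eq_zero_of_tendsto {𝕜 H U : Type*} [RCLike 𝕜]
    [NormedAddCommGroup H] [InnerProductSpace 𝕜 H] [CompleteSpace H]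
    [NormedAddCommGroup U] [InnerProductSpace 𝕜 U] [CompleteSpace U]
    {A : H →ₗ.[𝕜] H} {S : ℝ → H →L[𝕜] H} (hS : GeneratesContractionSemigroup A S)
    {B : U →L[𝕜] H} {T μ : ℝ} (hT : 0 ≤ T) (hUC : PEUniqueContinuation S B T μ)
    {α : ℕ → ℝ → ℝ} (hα : ∀ n, IsPESignal T μ (α n)) {x : H}
    (hlim : ∀ h, 0 ≤ h → Tendsto (fun n => ∫ s in (0 : ℝ)..h,
      α n s * ‖ContinuousLinearMap.adjoint B (S s x)‖ ^ 2) atTop (𝓝 0)) :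
    x = 0 := by
  obtain ⟨ϑ, hϑ, hUC⟩ := hUC
  -- `S` is uncontrolled at negative times; clamping makes `g` continuous on all of `ℝ`.
  set g : ℝ → ℝ := fun s => ‖ContinuousLinearMap.adjoint B (S (max s 0) x)‖ ^ 2 with hg
  have hgc : Continuous g := by
    have : Continuous fun s : ℝ => S (max s 0) x :=
      (hS.continuousOn_orbit x).comp_continuous (by fun_prop) fun s => le_max_right s 0
    exact ((ContinuousLinearMap.adjoint B).continuous.comp this).norm.pow 2
  have hgeq : ∀ s, 0 ≤ s → g s = ‖ContinuousLinearMap.adjoint B (S s x)‖ ^ 2 := fun s hs => by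
    simp only [hg, max_eq_left hs]
  -- After truncation, the integral over any window is at most the one over `(0, ϑ]`.
  set G : ℝ → ℝ := (Ioc 0 ϑ).indicator g with hG
  have hG0 : ∀ s, 0 ≤ G s := fun s => indicator_nonneg (fun s _ => sq_nonneg _) s
  have hmulG : ∀ n, (fun s => α n s * G s) = (Ioc 0 ϑ).indicator fun s => α n s * g s := fun n => by
    ext s
    by_cases h : s ∈ Ioc 0 ϑ <;> simp [hG, h]
  have hgi : ∀ n {a b : ℝ}, 0 ≤ a → a ≤ b → IntegrableOn (fun s => α n s * g s) (Ioc a b) :=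
    fun n a b ha hab => (intervalIntegrable_iff_integrableOn_Ioc_of_le hab).1
      ((hα n).intervalIntegrable_smul ha hab hgc.continuousOn)
  have hPE := isPESignal_indicator_zero_set hT hα (G := G)
    (hgc.measurable.indicator measurableSet_Ioc) hG0 ?_ ?_
  · refine hUC _ hPE x (intervalIntegral.integral_zero_ae (.of_forall fun s hs => ?_))
    rw [uIoc_of_le hϑ.le] at hs
    by_cases h : G s = 0
    · rw [hG, indicator_of_mem hs, hgeq s hs.1.le] at h
      rw [h, mul_zero]
    · rw [indicator_of_notMem (by simpa using h), zero_mul]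
  · intro n t ht
    have htT : t ≤ t + T := le_add_of_nonneg_right hT
    rw [hmulG, intervalIntegrable_iff_integrableOn_Ioc_of_le htT]
    exact (hgi n ht htT).indicator measurableSet_Ioc
  · intro t ht
    have htT : t ≤ t + T := le_add_of_nonneg_right hT
    refine squeeze_zero (fun n => ?_) (fun n => ?_) (hlim ϑ hϑ.le)
    · exact intervalIntegral.integral_nonneg htT fun s hs =>
        mul_nonneg ((hα n).mem_Icc s (ht.trans hs.1)).1 (hG0 s)
    · rw [hmulG, intervalIntegral.integral_of_le htT, intervalIntegral.integral_of_le hϑ.le,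
        setIntegral_indicator measurableSet_Ioc,
        ← setIntegral_congr_fun measurableSet_Ioc fun s hs => by
          rw [← hgeq s hs.1.le]]
      refine setIntegral_mono_set (hgi n le_rfl hϑ.le) ?_ (inter_subset_right.eventuallyLE)
      filter_upwards [ae_restrict_mem measurableSet_Ioc] with s hs
      exact (hα n).mul_sq_nonneg hs.1.le _

namespace IsMildSolution

variable {𝕜 H U : Type*} [RCLike 𝕜]
    [NormedAddCommGroup H] [InnerProductSpace 𝕜 H] [CompleteSpace H]
    [NormedSpace ℝ H] [IsScalarTower ℝ 𝕜 H]
    [NormedAddCommGroup U] [InnerProductSpace 𝕜 U] [CompleteSpace U]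
    {A : H →ₗ.[𝕜] H} {S : ℝ → H →L[𝕜] H} {B : U →L[𝕜] H} {T μ : ℝ} {α : ℝ → ℝ} {z₀ : H}
    {z : ℝ → H}

theorem tendsto_inner_translate (hS : GeneratesContractionSemigroup A S) (hα : IsPESignal T μ α)
    (hz : IsMildSolution S B α z₀ z) {t : ℕ → ℝ} (ht0 : ∀ n, 0 ≤ t n) (ht : Tendsto t atTop atTop)
    {y : H} (hy : ∀ x : H, Tendsto (fun n => inner 𝕜 (z (t n)) x) atTop (𝓝 (inner 𝕜 y x)))
    {h : ℝ} (hh : 0 ≤ h) (x : H) :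
    Tendsto (fun n => inner 𝕜 x (z (t n + h))) atTop (𝓝 (inner 𝕜 x (S h y))) := by
  have h₁ : Tendsto (fun n => inner 𝕜 x (z (t n + h) - S h (z (t n)))) atTop (𝓝 0) := by
    simpa using (tendsto_const_nhds (x := x)).inner (𝕜 := 𝕜)
      (hz.tendsto_sub_semigroup hS hα ht0 ht hh)
  have h₂ : Tendsto (fun n => inner 𝕜 x (S h (z (t n)))) atTop (𝓝 (inner 𝕜 x (S h y))) := by
    have := (RCLike.continuous_conj (K := 𝕜)).continuousAt.tendsto.comp
      (hy (ContinuousLinearMap.adjoint (S h) x))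
    simpa only [Function.comp_def, inner_conj_symm, ContinuousLinearMap.adjoint_inner_left]
      using this
  simpa [← inner_add_right] using h₁.add h₂

/-- For each `s`, moving `B*` across turns the pairing into a test of `S s y - z (t n + s)` against
a fixed vector; orbit bounds give domination. -/
theorem tendsto_integral_norm_inner (hS : GeneratesContractionSemigroup A S)
    (hα : IsPESignal T μ α) (hz : IsMildSolution S B α z₀ z) {t : ℕ → ℝ} (ht0 : ∀ n, 0 ≤ t n)
    (ht : Tendsto t atTop atTop) {y : H}
    (hy : ∀ x : H, Tendsto (fun n => inner 𝕜 (z (t n)) x) atTop (𝓝 (inner 𝕜 y x)))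
    {h : ℝ} (hh : 0 ≤ h) :
    Tendsto (fun n => ∫ s in (0 : ℝ)..h, ‖inner 𝕜 (ContinuousLinearMap.adjoint B (S s y))
      (ContinuousLinearMap.adjoint B (S s y) - ContinuousLinearMap.adjoint B (z (t n + s)))‖)
      atTop (𝓝 0) := by
  have hbc : ContinuousOn (fun s => ContinuousLinearMap.adjoint B (S s y)) (Ici 0) :=
    (ContinuousLinearMap.adjoint B).continuous.comp_continuousOn (hS.continuousOn_orbit y)
  have hcc : ∀ n, ContinuousOn (fun s => ContinuousLinearMap.adjoint B (z (t n + s))) (Ici 0) :=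
    fun n => hz.continuousOn_adjoint.comp (by fun_prop) fun s hs => add_nonneg (ht0 n) hs
  have hsub : uIoc 0 h ⊆ Ici 0 := fun s hs => by
    rw [uIoc_of_le hh] at hs
    exact hs.1.le
  have hlim := intervalIntegral.tendsto_integral_filter_of_dominated_convergence
    (μ := volume) (a := 0) (b := h) (l := atTop) (f := fun _ => (0 : ℝ))
    (F := fun n s => ‖inner 𝕜 (ContinuousLinearMap.adjoint B (S s y))
      (ContinuousLinearMap.adjoint B (S s y) - ContinuousLinearMap.adjoint B (z (t n + s)))‖)
    (fun _ => ‖ContinuousLinearMap.adjoint B‖ * ‖y‖ *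
      (‖ContinuousLinearMap.adjoint B‖ * ‖y‖ + ‖ContinuousLinearMap.adjoint B‖ * ‖z₀‖))
    (.of_forall fun n => ?_) (.of_forall fun n => .of_forall fun s hs => ?_)
    intervalIntegrable_const (.of_forall fun s hs => ?_)
  · simpa using hlim
  · exact (((hbc.inner (𝕜 := 𝕜) (hbc.sub (hcc n))).norm).mono hsub).aestronglyMeasurable
      measurableSet_uIoc
  · have hs0 : 0 ≤ s := hsub hs
    have h₁ : ‖ContinuousLinearMap.adjoint B (S s y)‖ ≤ ‖ContinuousLinearMap.adjoint B‖ * ‖y‖ :=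
      (ContinuousLinearMap.le_opNorm _ _).trans (by gcongr; exact hS.norm_apply_le hs0 y)
    have h₂ : ‖ContinuousLinearMap.adjoint B (z (t n + s))‖ ≤
        ‖ContinuousLinearMap.adjoint B‖ * ‖z₀‖ :=
      (ContinuousLinearMap.le_opNorm _ _).trans
        (by gcongr; exact hz.norm_le hS hα (add_nonneg (ht0 n) hs0))
    rw [norm_norm]
    exact (norm_inner_le_norm _ _).trans
      (mul_le_mul h₁ ((_root_.norm_sub_le _ _).trans (add_le_add h₁ h₂)) (norm_nonneg _)
        (by positivity))
  · have hs0 : 0 ≤ s := hsub hs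
    have h₁ := hz.tendsto_inner_translate hS hα ht0 ht hy hs0
      (B (ContinuousLinearMap.adjoint B (S s y)))
    simp_rw [← map_sub, ContinuousLinearMap.adjoint_inner_right, inner_sub_right]
    simpa using (h₁.const_sub
      (inner 𝕜 (B (ContinuousLinearMap.adjoint B (S s y))) (S s y))).norm

theorem weak_limit_eq_zero (hS : GeneratesContractionSemigroup A S) (hT : 0 ≤ T)
    (hUC : PEUniqueContinuation S B T μ) (hα : IsPESignal T μ α)
    (hz : IsMildSolution S B α z₀ z) {t : ℕ → ℝ} (ht0 : ∀ n, 0 ≤ t n)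
    (ht : Tendsto t atTop atTop) {y : H}
    (hy : ∀ x : H, Tendsto (fun n => inner 𝕜 (z (t n)) x) atTop (𝓝 (inner 𝕜 y x))) :
    y = 0 := by
  have hαt : ∀ n, IsPESignal T μ fun s => α (t n + s) := fun n => hα.comp_add_left (ht0 n)
  refine hUC.eq_zero_of_tendsto hS hT hαt fun h hh => ?_
  have hbc : ContinuousOn (fun s => ContinuousLinearMap.adjoint B (S s y)) (Icc 0 h) :=
    (ContinuousLinearMap.adjoint B).continuous.comp_continuousOn
      ((hS.continuousOn_orbit y).mono Icc_subset_Ici_self)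
  have hcc : ∀ n, ContinuousOn (fun s => ContinuousLinearMap.adjoint B (z (t n + s))) (Icc 0 h) :=
    fun n => hz.continuousOn_adjoint.comp (by fun_prop) fun s hs => add_nonneg (ht0 n) hs.1
  have hlim := ((hz.tendsto_integral_norm_inner hS hα ht0 ht hy hh).const_mul 2).add
    (hz.tendsto_integral_window hS hα ht0 ht hh)
  rw [mul_zero, add_zero] at hlim
  refine squeeze_zero (fun n => intervalIntegral.integral_nonneg hh fun s hs =>
    (hαt n).mul_sq_nonneg hs.1 _) (fun n => ?_) hlim
  have hI₁ : IntervalIntegrable (fun s => ‖inner 𝕜 (ContinuousLinearMap.adjoint B (S s y))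
      (ContinuousLinearMap.adjoint B (S s y) - ContinuousLinearMap.adjoint B (z (t n + s)))‖)
      volume 0 h :=
    ((hbc.inner (𝕜 := 𝕜) (hbc.sub (hcc n))).norm).intervalIntegrable_of_Icc hh
  have hI₂ : IntervalIntegrable (fun s => α (t n + s) *
      ‖ContinuousLinearMap.adjoint B (z (t n + s))‖ ^ 2) volume 0 h :=
    (hαt n).intervalIntegrable_smul le_rfl hh ((hcc n).norm.pow 2)
  have hshift : ∫ s in (t n)..(t n + h), α s * ‖ContinuousLinearMap.adjoint B (z s)‖ ^ 2 =
      ∫ s in (0 : ℝ)..h, α (t n + s) * ‖ContinuousLinearMap.adjoint B (z (t n + s))‖ ^ 2 := by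
    rw [intervalIntegral.integral_comp_add_left
      (fun s => α s * ‖ContinuousLinearMap.adjoint B (z s)‖ ^ 2), add_zero]
  rw [hshift, ← intervalIntegral.integral_const_mul,
    ← intervalIntegral.integral_add (hI₁.const_mul 2) hI₂]
  refine intervalIntegral.integral_mono_on hh
    ((hαt n).intervalIntegrable_smul le_rfl hh (hbc.norm.pow 2)) ((hI₁.const_mul 2).add hI₂)
    fun s hs => ?_
  obtain ⟨h0, h1⟩ := (hαt n).mem_Icc s hs.1
  -- The weight `α` is kept on the dissipation term and bounded by `1` on the pairing.
  have h₁ := mul_le_mul_of_nonneg_left (norm_sq_le_two_mul_norm_inner_sub_add (𝕜 := 𝕜)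
    (ContinuousLinearMap.adjoint B (S s y)) (ContinuousLinearMap.adjoint B (z (t n + s)))) h0
  rw [mul_add] at h₁
  exact h₁.trans (add_le_add_left (mul_le_of_le_one_left (by positivity) h1) _)

end IsMildSolution

/-! ### Weak convergence to zero -/

theorem theorem4p2 {𝕜 H U : Type*} [RCLike 𝕜]
    [NormedAddCommGroup H] [InnerProductSpace 𝕜 H] [CompleteSpace H]
    [NormedSpace ℝ H] [IsScalarTower ℝ 𝕜 H]
    [NormedAddCommGroup U] [InnerProductSpace 𝕜 U] [CompleteSpace U]
    (A : H →ₗ.[𝕜] H) (S : ℝ → H →L[𝕜] H) (hS : GeneratesContractionSemigroup A S)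
    (B : U →L[𝕜] H) (T μ : ℝ) (hμ : 0 < μ) (hμT : μ ≤ T)
    (hUC : PEUniqueContinuation S B T μ) :
    ∀ (α : ℝ → ℝ) (z₀ : H) (z : ℝ → H), IsPESignal T μ α → IsMildSolution S B α z₀ z →
      Tendsto (fun t : ℝ => toWeakSpace 𝕜 H (z t)) atTop (𝓝 0) := by
  intro α z₀ z hα hz
  refine (WeakBilin.tendsto_iff_forall_eval_tendsto (topDualPairing 𝕜 H).flip ?_).2 fun f => ?_
  · intro x y hxy
    refine ext_inner_left 𝕜 fun v => ?_
    exact LinearMap.congr_fun hxy (innerSL 𝕜 v)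
  refine tendsto_of_subseq_tendsto fun ns hns => ?_
  -- Finitely many times `ns n` may be negative, where `z` carries no information.
  set t : ℕ → ℝ := fun n => max (ns n) 0 with ht
  have ht0 : ∀ n, 0 ≤ t n := fun n => le_max_right _ _
  have htt : Tendsto t atTop atTop := tendsto_atTop_mono (fun n => le_max_left _ _) hns
  obtain ⟨y, φ, hφ, hy⟩ := exists_subseq_tendsto_inner 𝕜 (y := fun n => z (t n))
    fun n => hz.norm_le hS hα (ht0 n)
  have hy0 : y = 0 := hz.weak_limit_eq_zero hS (hμ.le.trans hμT) hUC hα (fun n => ht0 (φ n))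
    (htt.comp hφ.tendsto_atTop) hy
  refine ⟨φ, ?_⟩
  have hlim := (RCLike.continuous_conj (K := 𝕜)).continuousAt.tendsto.comp
    (hy ((InnerProductSpace.toDual 𝕜 H).symm f))
  simp only [Function.comp_def, inner_conj_symm, InnerProductSpace.toDual_symm_apply, hy0,
    map_zero] at hlim
  change Tendsto (fun n => f (z (ns (φ n)))) atTop (𝓝 (f 0))
  rw [map_zero]
  refine hlim.congr' ?_
  filter_upwards [(hns.comp hφ.tendsto_atTop).eventually_ge_atTop 0] with n hn
  exact congrArg (fun s => f (z s)) (max_eq_left hn)
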